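/- Let $n\ge 1$ and let $D\subset\mathbb C^n$ be a bounded strongly pseudoconvex domain (non-empty, open, connected) with $C^2$ defining function $\rho$, in the following sense: $\rho$ is a real-valued $C^2$ plurisubharmonic function on an open set $U\supseteq\overline D$ (for instance $U=\mathbb C^n$) such that $D=\{z\in U:\rho(z)<0\}$ and $\nabla\rho(z)\ne0$ for every $z\in\partial D$. (Strict plurisubharmonicity of $\rho$ is allowed but not required.) Let $t>-1$ and $1\le p<\infty$, and let $\mathcal A^p_t(D)$ be the weighted Bergman space of holomorphic functions $f:D\to\mathbb C$ with $$\|f\|_{\mathcal A^p_t(D)}:=\left(\int_D|f|^p(-\rho)^t\,dV\right)^{1/p}<\infty,$$ where $V$ is Lebesgue measure. For $\delta>0$ put $D_\delta:=\{z\in D:\operatorname{dist}(z,\partial D)>\delta\}$. Then a bounded set $\mathcal F\subseteq\mathcal A^p_t(D)$ is precompact (that is, has compact closure in $\mathcal A^p_t(D)$) if and only if $$\lim_{\delta\to0^+}\ \sup_{f\in\mathcal F}\int_{D\setminus D_\delta}|f|^p(-\rho)^t\,dV=0.$$ -/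

import Mathlib

open MeasureTheory Set Filter Topology
open scoped ENNReal

/-- A real-valued function `u` on a set `U ⊆ ℂⁿ` is plurisubharmonic: it is upper semicontinuous and
satisfies the sub-mean value inequality on every closed affine complex disc
`{z + ζ w : |ζ| ≤ 1}` contained in `U`. -/
def PlurisubharmonicOn {n : ℕ} (u : EuclideanSpace ℂ (Fin n) → ℝ)
    (U : Set (EuclideanSpace ℂ (Fin n))) : Prop :=
  UpperSemicontinuousOn u U ∧
    ∀ z w : EuclideanSpace ℂ (Fin n), (∀ ζ : ℂ, ‖ζ‖ ≤ 1 → z + ζ • w ∈ U) →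
      CircleIntegrable (fun ζ : ℂ => u (z + ζ • w)) 0 1 ∧
        u z ≤ Real.circleAverage (fun ζ : ℂ => u (z + ζ • w)) 0 1

/-- A bounded domain `D ⊆ ℂⁿ` together with a `C²` plurisubharmonic defining function `ρ`,
given on an open neighbourhood `U` of the closure of `D` (possibly all of `ℂⁿ`).
Plurisubharmonicity is not required to be strict, so that bounded strongly pseudoconvex domains
with a strictly plurisubharmonic defining function are included. -/
structure PshDomain (n : ℕ) where
  /-- the domain -/
  D : Set (EuclideanSpace ℂ (Fin n))
  /-- the defining function -/
  ρ : EuclideanSpace ℂ (Fin n) → ℝ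
  /-- the open set on which the defining function lives -/
  U : Set (EuclideanSpace ℂ (Fin n))
  isOpen_D : IsOpen D
  isConnected_D : IsConnected D
  isBounded_D : Bornology.IsBounded D
  isOpen_U : IsOpen U
  closure_subset : closure D ⊆ U
  contDiffOn : ContDiffOn ℝ 2 ρ U
  psh : PlurisubharmonicOn ρ U
  D_eq : D = {z ∈ U | ρ z < 0}
  fderiv_ne_zero : ∀ z ∈ frontier D, fderiv ℝ ρ z ≠ 0

namespace PshDomain

variable {n : ℕ} (Ω : PshDomain n)

/-- The weight `(-ρ)^t`. -/
noncomputable def weight (t : ℝ) (z : EuclideanSpace ℂ (Fin n)) : ℝ≥0∞ :=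
  ENNReal.ofReal ((-Ω.ρ z) ^ t)

/-- `D_δ = {z ∈ D : dist(z, ∂D) > δ}`. -/
def shrink (δ : ℝ) : Set (EuclideanSpace ℂ (Fin n)) :=
  {z ∈ Ω.D | δ < Metric.infDist z (frontier Ω.D)}

/-- `∫_S |f|^p (-ρ)^t dV`, with values in `[0, ∞]`. -/
noncomputable def energy (p t : ℝ) (S : Set (EuclideanSpace ℂ (Fin n)))
    (f : EuclideanSpace ℂ (Fin n) → ℂ) : ℝ≥0∞ :=
  ∫⁻ z in S, ‖f z‖ₑ ^ p * Ω.weight t z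

/-- The measure `(-ρ)^t dV` on `D`. -/
noncomputable def weightedVolume (t : ℝ) : Measure (EuclideanSpace ℂ (Fin n)) :=
  (volume.restrict Ω.D).withDensity (Ω.weight t)

theorem D_subset_U : Ω.D ⊆ Ω.U := subset_closure.trans Ω.closure_subset

theorem aemeasurable_weight (t : ℝ) : AEMeasurable (Ω.weight t) (volume.restrict Ω.D) := by
  have h : ContinuousOn Ω.ρ Ω.D := Ω.contDiffOn.continuousOn.mono Ω.D_subset_U
  have h1 : AEMeasurable Ω.ρ (volume.restrict Ω.D) := h.aemeasurable Ω.isOpen_D.measurableSet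
  exact (h1.neg.pow_const t).ennreal_ofReal

theorem weight_pos (t : ℝ) {z : EuclideanSpace ℂ (Fin n)} (hz : z ∈ Ω.D) : 0 < Ω.weight t z := by
  rw [Ω.D_eq] at hz
  exact ENNReal.ofReal_pos.2 (Real.rpow_pos_of_pos (neg_pos.2 hz.2) t)

theorem energy_eq_eLpNorm {p : ℝ} (hp : 1 ≤ p) (t : ℝ) {f : EuclideanSpace ℂ (Fin n) → ℂ}
    (hf : DifferentiableOn ℂ f Ω.D) :
    eLpNorm f (ENNReal.ofReal p) (Ω.weightedVolume t) = Ω.energy p t Ω.D f ^ (1 / p) := by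
  have hm : AEMeasurable f (volume.restrict Ω.D) :=
    hf.continuousOn.aemeasurable Ω.isOpen_D.measurableSet
  rw [eLpNorm_eq_lintegral_rpow_enorm_toReal (by simp; linarith) (by simp),
    ENNReal.toReal_ofReal (by linarith), energy, weightedVolume,
    lintegral_withDensity_eq_lintegral_mul₀ (Ω.aemeasurable_weight t) (hm.enorm.pow_const p)]
  simp [mul_comm]

theorem aestronglyMeasurable (t : ℝ) {f : EuclideanSpace ℂ (Fin n) → ℂ}
    (hf : DifferentiableOn ℂ f Ω.D) : AEStronglyMeasurable f (Ω.weightedVolume t) :=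
  (hf.continuousOn.aestronglyMeasurable Ω.isOpen_D.measurableSet).mono_ac
    (withDensity_absolutelyContinuous _ _)

theorem memLp_iff {p : ℝ} (hp : 1 ≤ p) (t : ℝ) {f : EuclideanSpace ℂ (Fin n) → ℂ}
    (hf : DifferentiableOn ℂ f Ω.D) :
    MemLp f (ENNReal.ofReal p) (Ω.weightedVolume t) ↔ Ω.energy p t Ω.D f < ∞ := by
  rw [MemLp, Ω.energy_eq_eLpNorm hp t hf, and_iff_right (Ω.aestronglyMeasurable t hf),
    ENNReal.rpow_lt_top_iff_of_pos (by positivity)]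

/-- The vector space of holomorphic functions `f : D → ℂ` with `∫_D |f|^p (-ρ)^t dV < ∞`.
A function on `D` is represented by its extension by zero to `ℂⁿ`. -/
def bergmanSubmodule (p t : ℝ) [hp : Fact (1 ≤ p)] : Submodule ℂ (EuclideanSpace ℂ (Fin n) → ℂ) where
  carrier := {f | DifferentiableOn ℂ f Ω.D ∧ (∀ z, z ∉ Ω.D → f z = 0) ∧ Ω.energy p t Ω.D f < ∞}
  zero_mem' := by
    refine ⟨differentiableOn_const 0, fun _ _ => rfl, ?_⟩
    refine (Ω.memLp_iff hp.out t (differentiableOn_const 0)).1 ?_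
    exact MemLp.zero
  add_mem' := by
    rintro f g ⟨hf, hf0, hfi⟩ ⟨hg, hg0, hgi⟩
    refine ⟨hf.add hg, fun z hz => by simp [hf0 z hz, hg0 z hz], ?_⟩
    exact (Ω.memLp_iff hp.out t (hf.add hg)).1
      (((Ω.memLp_iff hp.out t hf).2 hfi).add ((Ω.memLp_iff hp.out t hg).2 hgi))
  smul_mem' := by
    rintro c f ⟨hf, hf0, hfi⟩
    refine ⟨hf.const_smul c, fun z hz => by simp [hf0 z hz], ?_⟩
    exact (Ω.memLp_iff hp.out t (hf.const_smul c)).1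
      (((Ω.memLp_iff hp.out t hf).2 hfi).const_smul c)

/-- The weighted Bergman space `A^p_t(D)`, as a type of its own, so that its only topology and
bornology are those of the Bergman norm (and not those of pointwise convergence). -/
def BergmanSpace (p t : ℝ) [Fact (1 ≤ p)] : Type :=
  Ω.bergmanSubmodule p t

noncomputable instance (p t : ℝ) [Fact (1 ≤ p)] : AddCommGroup (Ω.BergmanSpace p t) :=
  inferInstanceAs (AddCommGroup (Ω.bergmanSubmodule p t))

noncomputable instance (p t : ℝ) [Fact (1 ≤ p)] : Module ℂ (Ω.BergmanSpace p t) :=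
  inferInstanceAs (Module ℂ (Ω.bergmanSubmodule p t))

/-- The function underlying an element of the weighted Bergman space. -/
def BergmanSpace.toFun {Ω : PshDomain n} {p t : ℝ} [Fact (1 ≤ p)] (f : Ω.BergmanSpace p t) :
    EuclideanSpace ℂ (Fin n) → ℂ :=
  Subtype.val (p := fun g => g ∈ Ω.bergmanSubmodule p t) f

theorem BergmanSpace.property {Ω : PshDomain n} {p t : ℝ} [Fact (1 ≤ p)]
    (f : Ω.BergmanSpace p t) : f.toFun ∈ Ω.bergmanSubmodule p t :=
  Subtype.property (p := fun g => g ∈ Ω.bergmanSubmodule p t) f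

theorem BergmanSpace.memLp {Ω : PshDomain n} {p t : ℝ} [hp : Fact (1 ≤ p)]
    (f : Ω.BergmanSpace p t) : MemLp f.toFun (ENNReal.ofReal p) (Ω.weightedVolume t) :=
  (Ω.memLp_iff hp.out t f.property.1).2 f.property.2.2

theorem rpow_toReal_energy {p t : ℝ} [hp : Fact (1 ≤ p)] (f : Ω.BergmanSpace p t) :
    (Ω.energy p t Ω.D f.toFun).toReal ^ (1 / p) =
      (eLpNorm f.toFun (ENNReal.ofReal p) (Ω.weightedVolume t)).toReal := by
  rw [Ω.energy_eq_eLpNorm hp.out t f.property.1, ENNReal.toReal_rpow]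

/-- The norm `‖f‖ = (∫_D |f|^p (-ρ)^t dV)^(1/p)` of the weighted Bergman space. -/
noncomputable def bergmanNorm (p t : ℝ) [hp : Fact (1 ≤ p)] :
    AddGroupNorm (Ω.BergmanSpace p t) where
  toFun f := (Ω.energy p t Ω.D f.toFun).toReal ^ (1 / p)
  map_zero' := by
    rw [Ω.rpow_toReal_energy (0 : Ω.BergmanSpace p t)]
    exact congrArg ENNReal.toReal eLpNorm_zero
  add_le' f g := by
    rw [Ω.rpow_toReal_energy f, Ω.rpow_toReal_energy g, Ω.rpow_toReal_energy (f + g)]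
    have hf := f.memLp
    have hg := g.memLp
    rw [← ENNReal.toReal_add hf.2.ne hg.2.ne]
    refine ENNReal.toReal_mono (ENNReal.add_lt_top.2 ⟨hf.2, hg.2⟩).ne ?_
    exact eLpNorm_add_le hf.1 hg.1 (by simpa using hp.out)
  neg' f := by
    rw [Ω.rpow_toReal_energy f, Ω.rpow_toReal_energy (-f)]
    exact congrArg ENNReal.toReal (eLpNorm_neg f.toFun _ _)
  eq_zero_of_map_eq_zero' f h := by
    rw [Ω.rpow_toReal_energy f] at h
    have hf := f.memLp
    have hp0 : ENNReal.ofReal p ≠ 0 := by simpa using lt_of_lt_of_le one_pos hp.out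
    rw [ENNReal.toReal_eq_zero_iff, or_iff_left hf.2.ne, eLpNorm_eq_zero_iff hf.1 hp0,
      weightedVolume, Filter.EventuallyEq, ae_withDensity_iff' (Ω.aemeasurable_weight t)] at h
    have h0 : f.toFun =ᵐ[volume.restrict Ω.D] 0 := by
      filter_upwards [h, ae_restrict_mem Ω.isOpen_D.measurableSet] with z hz hzD
      exact hz (Ω.weight_pos t hzD).ne'
    have h1 := Measure.eqOn_open_of_ae_eq h0 Ω.isOpen_D f.property.1.continuousOn continuousOn_const
    refine Subtype.ext (funext fun z => ?_)
    by_cases hz : z ∈ Ω.D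
    · exact h1 hz
    · exact f.property.2.1 z hz

noncomputable instance (p t : ℝ) [Fact (1 ≤ p)] : NormedAddCommGroup (Ω.BergmanSpace p t) :=
  (Ω.bergmanNorm p t).toNormedAddCommGroup

end PshDomain

/-! The Bergman space is complete (the `CompleteSpace` instance), so precompactness is total
boundedness, and loss of compactness can only come from mass escaping to the boundary. On a compact
part of `D` the weight is bounded below, so the sub-mean value inequality bounds point evaluations
(`exists_norm_apply_le`) and Cauchy's estimate bounds derivatives (`exists_norm_fderiv_le`).
Arzelà–Ascoli then gives every bounded family a finite uniform net there
(`exists_finite_net_of_isBounded`). Uniformly small tails near the boundary turn this into a net for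
the norm. Conversely, the tail of a single function vanishes by absolute continuity of the integral,
and a finite net makes this uniform. -/

/-! ### Sub-mean value inequalities on balls -/

theorem setLIntegral_ball_smul {n : ℕ} {c : ℂ} (hc : ‖c‖ = 1) (r : ℝ)
    (g : EuclideanSpace ℂ (Fin n) → ℝ≥0∞) :
    ∫⁻ w in Metric.ball 0 r, g (c • w) = ∫⁻ w in Metric.ball 0 r, g w := by
  have hc0 : c ≠ 0 := by rintro rfl; simp at hc
  let e : EuclideanSpace ℂ (Fin n) ≃ₗᵢ[ℝ] EuclideanSpace ℂ (Fin n) :=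
    ⟨(LinearEquiv.smulOfNeZero ℂ _ c hc0).restrictScalars ℝ, fun w => by
      simp [norm_smul, hc]⟩
  have he : ∀ w, e w = c • w := fun w => rfl
  have h := e.measurePreserving.setLIntegral_comp_preimage_emb
    e.toHomeomorph.measurableEmbedding g (Metric.ball 0 r)
  have hpre : e ⁻¹' Metric.ball 0 r = Metric.ball 0 r := by
    ext w
    simp
  rw [hpre] at h
  exact h

/-- Mean value property in one variable, for the slice `ζ ↦ f (z + ζ • w)`: the closed unit disc is
mapped into the ball. -/
theorem two_pi_mul_enorm_le_lintegral {n : ℕ} {f : EuclideanSpace ℂ (Fin n) → ℂ}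
    {z w : EuclideanSpace ℂ (Fin n)} {r : ℝ} (hf : DifferentiableOn ℂ f (Metric.ball z r))
    (hw : w ∈ Metric.ball 0 r) :
    ENNReal.ofReal (2 * Real.pi) * ‖f z‖ₑ ≤
      ∫⁻ θ in Ioc 0 (2 * Real.pi), ‖f (z + circleMap 0 1 θ • w)‖ₑ := by
  have hmaps : MapsTo (fun ζ : ℂ => z + ζ • w) (Metric.closedBall 0 1) (Metric.ball z r) := by
    intro ζ hζ
    simp only [Metric.mem_closedBall, dist_zero_right, Metric.mem_ball, dist_self_add_left,
      norm_smul] at hζ hw ⊢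
    nlinarith [norm_nonneg w]
  have hd : DifferentiableOn ℂ (fun ζ : ℂ => f (z + ζ • w)) (Metric.closedBall 0 1) :=
    hf.comp (by fun_prop) hmaps
  have hdc : DiffContOnCl ℂ (fun ζ : ℂ => f (z + ζ • w)) (Metric.ball 0 |1|) := by
    rw [abs_one]
    refine DifferentiableOn.diffContOnCl ?_
    rwa [closure_ball _ one_ne_zero]
  have h := hdc.circleAverage
  simp only [zero_smul, add_zero, Real.circleAverage] at h
  have h2 : ((2 * Real.pi : ℝ) : ℂ) * f z =
      ∫ θ in Ioc 0 (2 * Real.pi), f (z + circleMap 0 1 θ • w) := by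
    rw [← h, intervalIntegral.integral_of_le Real.two_pi_pos.le, Complex.real_smul,
      ← mul_assoc, ← Complex.ofReal_mul, mul_inv_cancel₀ Real.two_pi_pos.ne', Complex.ofReal_one,
      one_mul]
  calc ENNReal.ofReal (2 * Real.pi) * ‖f z‖ₑ = ‖((2 * Real.pi : ℝ) : ℂ) * f z‖ₑ := by
        rw [enorm_mul, ← ofReal_norm (((2 * Real.pi : ℝ) : ℂ)), Complex.norm_real,
          Real.norm_of_nonneg Real.two_pi_pos.le]
    _ ≤ _ := h2 ▸ enorm_integral_le_lintegral_enorm _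

/-- The sub-mean value inequality for `|f|` on balls, for `f` holomorphic. -/
theorem enorm_mul_volume_ball_le {n : ℕ} {f : EuclideanSpace ℂ (Fin n) → ℂ}
    {z : EuclideanSpace ℂ (Fin n)} {r : ℝ} (hf : DifferentiableOn ℂ f (Metric.ball z r)) :
    ‖f z‖ₑ * volume (Metric.ball z r) ≤ ∫⁻ w in Metric.ball z r, ‖f w‖ₑ := by
  have htrans : ∫⁻ w in Metric.ball 0 r, ‖f (z + w)‖ₑ = ∫⁻ w in Metric.ball z r, ‖f w‖ₑ := by
    have h := (measurePreserving_add_left volume z).setLIntegral_comp_preimage_emb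
      (measurableEmbedding_addLeft z) (fun w => ‖f w‖ₑ) (Metric.ball z r)
    have hpre : (z + ·) ⁻¹' Metric.ball z r = Metric.ball 0 r := by
      ext w
      simp
    rwa [hpre] at h
  have hvol : volume (Metric.ball z r) = volume (Metric.ball (0 : EuclideanSpace ℂ (Fin n)) r) :=
    Measure.addHaar_ball_center _ _ _
  have hmeas : AEMeasurable (Function.uncurry fun (w : EuclideanSpace ℂ (Fin n)) (θ : ℝ) =>
      ‖f (z + circleMap 0 1 θ • w)‖ₑ)
      ((volume.restrict (Metric.ball 0 r)).prod (volume.restrict (Ioc 0 (2 * Real.pi)))) := by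
    rw [Measure.prod_restrict]
    refine ContinuousOn.aemeasurable ?_ (measurableSet_ball.prod measurableSet_Ioc)
    refine continuous_enorm.comp_continuousOn (hf.continuousOn.comp
      (f := fun q : EuclideanSpace ℂ (Fin n) × ℝ => z + circleMap 0 1 q.2 • q.1) ?_ ?_)
    · have := continuous_circleMap 0 1
      fun_prop
    · intro q hq
      simpa [norm_smul] using hq.1
  have hpi : ENNReal.ofReal (2 * Real.pi) ≠ 0 := by simp [Real.pi_pos]
  -- Integrate the circle inequality over all `w` and swap the integrals: by rotation invariance the
  -- inner integral does not depend on `θ`.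
  rw [← ENNReal.mul_le_mul_iff_right hpi ENNReal.ofReal_ne_top, ← mul_assoc]
  calc ENNReal.ofReal (2 * Real.pi) * ‖f z‖ₑ * volume (Metric.ball z r)
      = ∫⁻ _ in Metric.ball (0 : EuclideanSpace ℂ (Fin n)) r,
          ENNReal.ofReal (2 * Real.pi) * ‖f z‖ₑ := by rw [setLIntegral_const, hvol]
    _ ≤ ∫⁻ w in Metric.ball 0 r, ∫⁻ θ in Ioc 0 (2 * Real.pi),
          ‖f (z + circleMap 0 1 θ • w)‖ₑ :=
        setLIntegral_mono' measurableSet_ball fun w hw => two_pi_mul_enorm_le_lintegral hf hw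
    _ = ∫⁻ θ in Ioc 0 (2 * Real.pi), ∫⁻ w in Metric.ball 0 r,
          ‖f (z + circleMap 0 1 θ • w)‖ₑ := lintegral_lintegral_swap hmeas
    _ = ∫⁻ _ in Ioc 0 (2 * Real.pi), ∫⁻ w in Metric.ball z r, ‖f w‖ₑ := by
        congr 1 with θ
        rw [setLIntegral_ball_smul (by simp) r fun w => ‖f (z + w)‖ₑ, htrans]
    _ = _ := by
        rw [setLIntegral_const, Real.volume_Ioc, sub_zero, mul_comm]

/-- Hölder's inequality applied to the `L¹` bound. -/
theorem enorm_mul_volume_ball_le_rpow {n : ℕ} {f : EuclideanSpace ℂ (Fin n) → ℂ}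
    {z : EuclideanSpace ℂ (Fin n)} {r p : ℝ} (hp : 1 ≤ p)
    (hf : DifferentiableOn ℂ f (Metric.ball z r)) :
    ‖f z‖ₑ * volume (Metric.ball z r) ≤
      (∫⁻ w in Metric.ball z r, ‖f w‖ₑ ^ p) ^ (1 / p) *
        volume (Metric.ball z r) ^ (1 - 1 / p) := by
  have hm : AEStronglyMeasurable f (volume.restrict (Metric.ball z r)) :=
    hf.continuousOn.aestronglyMeasurable measurableSet_ball
  have h := eLpNorm_le_eLpNorm_mul_rpow_measure_univ (p := 1) (q := ENNReal.ofReal p)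
    (by simpa using hp) hm
  rw [eLpNorm_one_eq_lintegral_enorm,
    eLpNorm_eq_lintegral_rpow_enorm_toReal (by simp; linarith) (by simp),
    ENNReal.toReal_ofReal (by linarith), Measure.restrict_apply_univ, ENNReal.toReal_one,
    div_one] at h
  exact (enorm_mul_volume_ball_le hf).trans h

/-! ### Interior estimates and completeness -/

namespace PshDomain

variable {n : ℕ} (Ω : PshDomain n)

theorem continuousOn_weight (t : ℝ) : ContinuousOn (Ω.weight t) Ω.D := by
  have h : ContinuousOn Ω.ρ Ω.D := Ω.contDiffOn.continuousOn.mono Ω.D_subset_U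
  refine ENNReal.continuous_ofReal.comp_continuousOn (h.neg.rpow_const fun z hz => Or.inl ?_)
  rw [Ω.D_eq] at hz
  exact (neg_pos.2 hz.2).ne'

theorem exists_le_weight (t : ℝ) {K : Set (EuclideanSpace ℂ (Fin n))} (hK : IsCompact K)
    (hKD : K ⊆ Ω.D) : ∃ c : ℝ≥0∞, c ≠ 0 ∧ ∀ z ∈ K, c ≤ Ω.weight t z := by
  rcases K.eq_empty_or_nonempty with rfl | hne
  · exact ⟨1, one_ne_zero, by simp⟩
  · obtain ⟨z, hz, hmin⟩ := hK.exists_isMinOn hne ((Ω.continuousOn_weight t).mono hKD)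
    exact ⟨Ω.weight t z, (Ω.weight_pos t (hKD hz)).ne', fun w hw => hmin hw⟩

theorem setLIntegral_weight_lt_top (t : ℝ) {K : Set (EuclideanSpace ℂ (Fin n))}
    (hK : IsCompact K) (hKD : K ⊆ Ω.D) : ∫⁻ z in K, Ω.weight t z < ∞ := by
  rcases K.eq_empty_or_nonempty with rfl | hne
  · simp
  · obtain ⟨z, hz, hmax⟩ := hK.exists_isMaxOn hne ((Ω.continuousOn_weight t).mono hKD)
    calc ∫⁻ w in K, Ω.weight t w ≤ ∫⁻ _ in K, Ω.weight t z :=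
          setLIntegral_mono' hK.measurableSet fun w hw => hmax hw
      _ < ∞ := by
          rw [setLIntegral_const]
          exact ENNReal.mul_lt_top ENNReal.ofReal_lt_top hK.measure_lt_top

theorem ofReal_norm_bergman {p t : ℝ} [hp : Fact (1 ≤ p)] (f : Ω.BergmanSpace p t) :
    ENNReal.ofReal ‖f‖ = Ω.energy p t Ω.D f.toFun ^ (1 / p) := by
  have hp0 : 0 ≤ 1 / p := by have := hp.out; positivity
  have h : ‖f‖ = (Ω.energy p t Ω.D f.toFun).toReal ^ (1 / p) := rfl
  rw [h, ← ENNReal.ofReal_rpow_of_nonneg ENNReal.toReal_nonneg hp0,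
    ENNReal.ofReal_toReal f.property.2.2.ne]

theorem energy_eq_ofReal_norm_rpow {p t : ℝ} [hp : Fact (1 ≤ p)] (f : Ω.BergmanSpace p t) :
    Ω.energy p t Ω.D f.toFun = ENNReal.ofReal ‖f‖ ^ p := by
  have hp0 : p ≠ 0 := by have := hp.out; positivity
  rw [Ω.ofReal_norm_bergman, ← ENNReal.rpow_mul, one_div_mul_cancel hp0, ENNReal.rpow_one]

theorem toFun_sub {p t : ℝ} [Fact (1 ≤ p)] (f g : Ω.BergmanSpace p t) (z) :
    (f - g).toFun z = f.toFun z - g.toFun z := rfl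

/-- Point evaluations on the weighted Bergman space are bounded, uniformly on compact sets. -/
theorem exists_norm_apply_le (p t : ℝ) [hp : Fact (1 ≤ p)] {K : Set (EuclideanSpace ℂ (Fin n))}
    (hK : IsCompact K) (hKD : K ⊆ Ω.D) :
    ∃ C : ℝ, 0 ≤ C ∧ ∀ f : Ω.BergmanSpace p t, ∀ z ∈ K, ‖f.toFun z‖ ≤ C * ‖f‖ := by
  have hp0 : 0 < p := one_pos.trans_le hp.out
  -- The balls of this one radius about points of `K` all lie in a compact subset of `D`, so a
  -- single lower bound `c` for the weight serves them all.
  obtain ⟨r, hr, hrD⟩ := hK.exists_cthickening_subset_open Ω.isOpen_D hKD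
  obtain ⟨c, hc0, hc⟩ := Ω.exists_le_weight t hK.cthickening hrD
  obtain ⟨v, hv⟩ : ∃ v, v = volume (Metric.ball (0 : EuclideanSpace ℂ (Fin n)) r) := ⟨_, rfl⟩
  have hv0 : v ≠ 0 := hv ▸ (Metric.measure_ball_pos _ _ hr).ne'
  have hvt : v ≠ ∞ := hv ▸ measure_ball_lt_top.ne
  obtain ⟨C, hC⟩ : ∃ C, C = v⁻¹ * ((c⁻¹) ^ (1 / p) * v ^ (1 - 1 / p)) := ⟨_, rfl⟩
  have hCt : C ≠ ∞ := by
    rw [hC]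
    refine ENNReal.mul_ne_top (ENNReal.inv_ne_top.2 hv0) (ENNReal.mul_ne_top ?_ ?_)
    · exact ENNReal.rpow_ne_top_of_nonneg (by positivity) (ENNReal.inv_ne_top.2 hc0)
    · refine ENNReal.rpow_ne_top_of_nonneg ?_ hvt
      rw [sub_nonneg, div_le_one hp0]
      exact hp.out
  refine ⟨C.toReal, ENNReal.toReal_nonneg, fun f z hz => ?_⟩
  have hball : Metric.ball z r ⊆ Metric.cthickening r K :=
    Metric.ball_subset_closedBall.trans (Metric.closedBall_subset_cthickening hz r)
  have h1 := enorm_mul_volume_ball_le_rpow hp.out (f.property.1.mono (hball.trans hrD))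
  rw [Measure.addHaar_ball_center, ← hv] at h1
  have h2 : ∫⁻ w in Metric.ball z r, ‖f.toFun w‖ₑ ^ p ≤ c⁻¹ * Ω.energy p t Ω.D f.toFun := by
    have hct : c ≠ ∞ := ((hc z (Metric.self_subset_cthickening K hz)).trans_lt
      ENNReal.ofReal_lt_top).ne
    rw [← ENNReal.div_eq_inv_mul, ENNReal.le_div_iff_mul_le (Or.inl hc0) (Or.inl hct),
      ← lintegral_mul_const' _ _ hct]
    calc _ ≤ ∫⁻ w in Metric.ball z r, ‖f.toFun w‖ₑ ^ p * Ω.weight t w :=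
          setLIntegral_mono' measurableSet_ball fun w hw => by gcongr; exact hc w (hball hw)
      _ ≤ _ := lintegral_mono_set (hball.trans hrD)
  have h3 : ‖f.toFun z‖ₑ ≤ C * ENNReal.ofReal ‖f‖ := by
    rw [Ω.ofReal_norm_bergman]
    calc ‖f.toFun z‖ₑ = v⁻¹ * (‖f.toFun z‖ₑ * v) := by
          rw [mul_comm, mul_assoc, ENNReal.mul_inv_cancel hv0 hvt, mul_one]
      _ ≤ v⁻¹ * ((c⁻¹ * Ω.energy p t Ω.D f.toFun) ^ (1 / p) * v ^ (1 - 1 / p)) := by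
          refine mul_le_mul_right (h1.trans ?_) _
          gcongr
      _ = _ := by
          rw [ENNReal.mul_rpow_of_nonneg _ _ (by positivity), hC]
          ring
  have h4 := ENNReal.toReal_mono (ENNReal.mul_ne_top hCt ENNReal.ofReal_ne_top) h3
  rwa [toReal_enorm, ENNReal.toReal_mul, ENNReal.toReal_ofReal (norm_nonneg _)] at h4

/-- Cauchy estimates on the weighted Bergman space. -/
theorem exists_norm_fderiv_le (p t : ℝ) [Fact (1 ≤ p)] {K : Set (EuclideanSpace ℂ (Fin n))}
    (hK : IsCompact K) (hKD : K ⊆ Ω.D) :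
    ∃ C : ℝ, 0 ≤ C ∧ ∀ f : Ω.BergmanSpace p t, ∀ z ∈ K, ‖fderiv ℂ f.toFun z‖ ≤ C * ‖f‖ := by
  obtain ⟨r, hr, hrD⟩ := hK.exists_cthickening_subset_open Ω.isOpen_D hKD
  obtain ⟨C, hC0, hC⟩ := Ω.exists_norm_apply_le p t hK.cthickening hrD
  refine ⟨2 * C / r, by positivity, fun f z hz => ?_⟩
  have hball : Metric.ball z r ⊆ Metric.cthickening r K :=
    Metric.ball_subset_closedBall.trans (Metric.closedBall_subset_cthickening hz r)
  have h := Complex.norm_fderiv_le_div_of_mapsTo_ball (R₂ := 2 * (C * ‖f‖))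
    (f.property.1.mono (hball.trans hrD)) (fun w hw => ?_) hr
  · rwa [div_mul_eq_mul_div, mul_assoc]
  · rw [mem_closedBall_iff_norm]
    have h1 := hC f w (hball hw)
    have h2 := hC f z (hball (Metric.mem_ball_self hr))
    linarith [norm_sub_le (f.toFun w) (f.toFun z)]

/-- The limit of a sequence which is Cauchy in the weighted Bergman space is holomorphic. -/
theorem exists_differentiableOn_tendsto {p t : ℝ} [Fact (1 ≤ p)] {u : ℕ → Ω.BergmanSpace p t}
    (hu : CauchySeq u) : ∃ g : EuclideanSpace ℂ (Fin n) → ℂ, DifferentiableOn ℂ g Ω.D ∧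
      (∀ z, z ∉ Ω.D → g z = 0) ∧
      ∀ z, Tendsto (fun k => (u k).toFun z) atTop (𝓝 (g z)) := by
  have hpt : ∀ z, ∃ a, Tendsto (fun k => (u k).toFun z) atTop (𝓝 a) := by
    intro z
    by_cases hz : z ∈ Ω.D
    · obtain ⟨C, hC0, hC⟩ := Ω.exists_norm_apply_le p t isCompact_singleton
        (singleton_subset_iff.2 hz)
      refine cauchySeq_tendsto_of_complete (Metric.cauchySeq_iff.2 fun ε hε => ?_)
      obtain ⟨N, hN⟩ := Metric.cauchySeq_iff.1 hu (ε / (C + 1)) (by positivity)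
      refine ⟨N, fun i hi j hj => ?_⟩
      have h1 := hC (u i - u j) z rfl
      have h2 := hN i hi j hj
      rw [dist_eq_norm, lt_div_iff₀ (by positivity)] at h2
      rw [dist_eq_norm, ← toFun_sub]
      nlinarith [norm_nonneg (u i - u j)]
    · exact ⟨0, tendsto_const_nhds.congr fun k => ((u k).property.2.1 z hz).symm⟩
  choose g hg using hpt
  refine ⟨g, fun z hz => ?_, fun z hz => ?_, hg⟩
  · obtain ⟨r, hr, hrD⟩ := Metric.nhds_basis_closedBall.mem_iff.1 (Ω.isOpen_D.mem_nhds hz)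
    obtain ⟨C, hC0, hC⟩ := Ω.exists_norm_fderiv_le p t (isCompact_closedBall z r) hrD
    have hdiff : ∀ k, ∀ w ∈ Metric.ball z r, HasFDerivAt (u k).toFun (fderiv ℂ (u k).toFun w) w :=
      fun k w hw => ((u k).property.1.differentiableAt
        (Ω.isOpen_D.mem_nhds (hrD (Metric.ball_subset_closedBall hw)))).hasFDerivAt
    -- Cauchy's estimate for the differences `u i - u j` gives locally uniform convergence of
    -- derivatives, hence differentiability of the pointwise limit.
    have hcau : UniformCauchySeqOn (fun k => fderiv ℂ (u k).toFun) atTop (Metric.ball z r) := by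
      refine Metric.uniformCauchySeqOn_iff.2 fun ε hε => ?_
      obtain ⟨N, hN⟩ := Metric.cauchySeq_iff.1 hu (ε / (C + 1)) (by positivity)
      refine ⟨N, fun i hi j hj w hw => ?_⟩
      have h1 := hC (u i - u j) w (Metric.ball_subset_closedBall hw)
      have h2 := hN i hi j hj
      have h3 : fderiv ℂ (u i - u j).toFun w = fderiv ℂ (u i).toFun w - fderiv ℂ (u j).toFun w :=
        ((hdiff i w hw).sub (hdiff j w hw)).fderiv
      rw [dist_eq_norm, lt_div_iff₀ (by positivity)] at h2
      rw [dist_eq_norm, ← h3]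
      nlinarith [norm_nonneg (u i - u j)]
    have hlim : ∀ w, ∃ L, w ∈ Metric.ball z r →
        Tendsto (fun k => fderiv ℂ (u k).toFun w) atTop (𝓝 L) := by
      intro w
      by_cases hw : w ∈ Metric.ball z r
      · obtain ⟨L, hL⟩ := cauchySeq_tendsto_of_complete (hcau.cauchySeq hw)
        exact ⟨L, fun _ => hL⟩
      · exact ⟨0, fun h => absurd h hw⟩
    choose g' hg' using hlim
    exact (hasFDerivAt_of_tendstoUniformlyOn Metric.isOpen_ball
      (hcau.tendstoUniformlyOn_of_tendsto hg') hdiff (fun w _ => hg w)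
      (Metric.mem_ball_self hr)).differentiableAt.differentiableWithinAt
  · exact tendsto_nhds_unique (hg z)
      (tendsto_const_nhds.congr fun k => ((u k).property.2.1 z hz).symm)

instance (p t : ℝ) [hp : Fact (1 ≤ p)] : CompleteSpace (Ω.BergmanSpace p t) := by
  refine Metric.complete_of_cauchySeq_tendsto fun u hu => ?_
  obtain ⟨g, hgd, hg0, hg⟩ := Ω.exists_differentiableOn_tendsto hu
  have hp0 : 0 < p := one_pos.trans_le hp.out
  -- Fatou's lemma as `j → ∞`: pointwise convergence suffices. It yields both membership of `g` in
  -- the space and convergence in norm.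
  have key : ∀ N k, ∀ ε : ℝ, 0 ≤ ε → (∀ j ≥ N, dist (u k) (u j) ≤ ε) →
      eLpNorm (fun z => (u k).toFun z - g z) (ENNReal.ofReal p) (Ω.weightedVolume t) ≤
        ENNReal.ofReal ε := by
    intro N k ε hε hkj
    refine (Lp.eLpNorm_lim_le_liminf_eLpNorm (f := fun j => (u k - u j).toFun)
      (fun j => (u k - u j).memLp.1) _ (ae_of_all _ fun z => (hg z).const_sub _)).trans ?_
    refine liminf_le_of_frequently_le' (Eventually.frequently ?_)
    filter_upwards [eventually_ge_atTop N] with j hj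
    rw [Ω.energy_eq_eLpNorm hp.out t (u k - u j).property.1, ← Ω.ofReal_norm_bergman,
      ← dist_eq_norm]
    exact ENNReal.ofReal_le_ofReal (hkj j hj)
  have hmem : Ω.energy p t Ω.D g < ∞ := by
    obtain ⟨N, hN⟩ := Metric.cauchySeq_iff.1 hu 1 one_pos
    have h1 := key N N 1 zero_le_one fun j hj => (hN N le_rfl j hj).le
    have h2 : MemLp (fun z => (u N).toFun z - g z) (ENNReal.ofReal p) (Ω.weightedVolume t) :=
      ⟨Ω.aestronglyMeasurable t ((u N).property.1.sub hgd), h1.trans_lt ENNReal.ofReal_lt_top⟩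
    refine (Ω.memLp_iff hp.out t hgd).1 ?_
    convert (u N).memLp.sub h2 using 1
    ext z
    simp
  let G : Ω.BergmanSpace p t := ⟨g, hgd, hg0, hmem⟩
  refine ⟨G, Metric.tendsto_atTop.2 fun ε hε => ?_⟩
  obtain ⟨N, hN⟩ := Metric.cauchySeq_iff.1 hu (ε / 2) (by positivity)
  refine ⟨N, fun k hk => ?_⟩
  have h := key N k (ε / 2) (by positivity) fun j hj => (hN k hk j hj).le
  change eLpNorm (u k - G).toFun _ _ ≤ _ at h
  rw [Ω.energy_eq_eLpNorm hp.out t (u k - G).property.1, ← Ω.ofReal_norm_bergman,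
    ENNReal.ofReal_le_ofReal_iff (by positivity), ← dist_eq_norm] at h
  linarith

end PshDomain

theorem ENNReal.exists_pos_mul_ofReal_rpow_le {p : ℝ} (hp : 0 < p) {c ε : ℝ≥0∞} (hc : c ≠ ∞)
    (hε : 0 < ε) : ∃ η : ℝ, 0 < η ∧ c * ENNReal.ofReal η ^ p ≤ ε := by
  have h : Tendsto (fun η : ℝ => c * ENNReal.ofReal η ^ p) (𝓝[>] 0) (𝓝 0) := by
    have h1 : Tendsto (fun η : ℝ => ENNReal.ofReal η ^ p) (𝓝[>] 0) (𝓝 0) := by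
      have h2 : Continuous fun η : ℝ => ENNReal.ofReal η ^ p :=
        (ENNReal.continuous_rpow_const).comp ENNReal.continuous_ofReal
      have h3 := (h2.tendsto 0).mono_left (nhdsWithin_le_nhds (s := Ioi 0))
      simpa [hp] using h3
    simpa using ENNReal.Tendsto.const_mul h1 (Or.inr hc)
  obtain ⟨η, h1, h2⟩ := ((ENNReal.tendsto_nhds_zero.1 h ε hε).and self_mem_nhdsWithin).exists
  exact ⟨η, h2, h1⟩

/-! ### Boundary tails and total boundedness -/

namespace PshDomain

variable {n : ℕ} (Ω : PshDomain n)

theorem isOpen_shrink (δ : ℝ) : IsOpen (Ω.shrink δ) :=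
  Ω.isOpen_D.inter (isOpen_lt continuous_const (Metric.continuous_infDist_pt _))

/-- Convexity of `x ↦ x ^ p`. This replaces Minkowski's inequality and avoids `p`-th roots. -/
theorem energy_le_mul_energy_add_energy_sub {p : ℝ} (hp : 1 ≤ p) (t : ℝ)
    {S : Set (EuclideanSpace ℂ (Fin n))} (hS : MeasurableSet S) (hSD : S ⊆ Ω.D)
    {f g h : EuclideanSpace ℂ (Fin n) → ℂ} (hg : DifferentiableOn ℂ g Ω.D)
    (hfgh : ∀ z, ‖f z‖ₑ ≤ ‖g z‖ₑ + ‖h z‖ₑ) :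
    Ω.energy p t S f ≤ 2 ^ (p - 1) * (Ω.energy p t S g + Ω.energy p t S h) := by
  have hm : AEMeasurable (fun z => ‖g z‖ₑ ^ p * Ω.weight t z) (volume.restrict S) :=
    ((((hg.continuousOn.mono hSD).aemeasurable hS).enorm).pow_const p).mul
      (((Ω.continuousOn_weight t).mono hSD).aemeasurable hS)
  have hp0 : 0 ≤ p - 1 := by linarith
  rw [energy, energy, energy, ← lintegral_add_left' hm,
    ← lintegral_const_mul' _ _ (ENNReal.rpow_ne_top_of_nonneg hp0 ENNReal.ofNat_ne_top)]
  refine lintegral_mono fun z => ?_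
  rw [← add_mul, ← mul_assoc]
  gcongr
  exact (ENNReal.rpow_le_rpow (hfgh z) (by linarith)).trans
    (ENNReal.rpow_add_le_mul_rpow_add_rpow _ _ hp)

theorem tendsto_energy_diff_shrink (hn : 1 ≤ n) {p t : ℝ} [Fact (1 ≤ p)]
    (f : Ω.BergmanSpace p t) :
    Tendsto (fun δ : ℝ => Ω.energy p t (Ω.D \ Ω.shrink δ) f.toFun) (𝓝[>] 0) (𝓝 0) := by
  have hmeas : ∀ δ, MeasurableSet (Ω.D \ Ω.shrink δ) := fun δ =>
    Ω.isOpen_D.measurableSet.diff (Ω.isOpen_shrink δ).measurableSet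
  -- `Metric.infDist` to the empty set is `0`, which would make every `Ω.shrink δ` with `δ > 0`
  -- empty; `1 ≤ n` rules this out.
  have hfr : (frontier Ω.D).Nonempty := by
    have : Nonempty (Fin n) := ⟨⟨0, hn⟩⟩
    rw [nonempty_iff_ne_empty, Ne, frontier_eq_empty_iff, not_or]
    refine ⟨Ω.isConnected_D.nonempty.ne_empty, fun h => ?_⟩
    exact NormedSpace.unbounded_univ ℂ (EuclideanSpace ℂ (Fin n)) (h ▸ Ω.isBounded_D)
  have hempty : ⋂ δ > (0 : ℝ), Ω.D \ Ω.shrink δ = ∅ := by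
    refine eq_empty_of_forall_notMem fun z hz => ?_
    simp only [mem_iInter] at hz
    have hzD := (hz 1 one_pos).1
    have hzf : z ∉ frontier Ω.D := fun h => by
      rw [Ω.isOpen_D.frontier_eq] at h
      exact h.2 hzD
    have hpos := (isClosed_frontier.notMem_iff_infDist_pos hfr).1 hzf
    exact (hz _ (half_pos hpos)).2 ⟨hzD, half_lt_self hpos⟩
  have hvol : Tendsto (volume.restrict Ω.D ∘ fun δ => Ω.D \ Ω.shrink δ) (𝓝[>] 0) (𝓝 0) := by
    have h := tendsto_measure_biInter_gt (μ := volume.restrict Ω.D)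
      (s := fun δ => Ω.D \ Ω.shrink δ) (a := (0 : ℝ))
      (fun δ _ => (hmeas δ).nullMeasurableSet)
      (fun i j _ hij z hz => ⟨hz.1, fun h => hz.2 ⟨h.1, hij.trans_lt h.2⟩⟩)
      ⟨1, one_pos, ((measure_mono (subset_univ _)).trans_lt
        (by rw [Measure.restrict_apply_univ]; exact Ω.isBounded_D.measure_lt_top)).ne⟩
    rwa [hempty, measure_empty] at h
  have h := tendsto_setLIntegral_zero (μ := volume.restrict Ω.D) f.property.2.2.ne hvol
  refine h.congr fun δ => ?_
  rw [Measure.restrict_restrict (hmeas δ), inter_eq_left.2 sdiff_subset, energy]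

theorem exists_finite_net_of_isBounded {p t : ℝ} [Fact (1 ≤ p)]
    {K : Set (EuclideanSpace ℂ (Fin n))} (hK : IsCompact K) (hKD : K ⊆ Ω.D)
    {F : Set (Ω.BergmanSpace p t)} (hF : Bornology.IsBounded F) {η : ℝ} (hη : 0 < η) :
    ∃ T ⊆ F, T.Finite ∧ ∀ f ∈ F, ∃ g ∈ T, ∀ z ∈ K, ‖(f - g).toFun z‖ ≤ η := by
  have : CompactSpace K := isCompact_iff_compactSpace.1 hK
  obtain ⟨M, hM0, hM⟩ := hF.exists_pos_norm_le
  let R : Ω.BergmanSpace p t → BoundedContinuousFunction K ℂ := fun f =>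
    BoundedContinuousFunction.mkOfCompact
      ⟨K.domRestrict f.toFun, (f.property.1.continuousOn.mono hKD).domRestrict⟩
  have hR : ∀ f z, R f z = f.toFun z := fun f z => rfl
  obtain ⟨C, hC0, hC⟩ := Ω.exists_norm_apply_le p t hK hKD
  have hcpt : IsCompact (closure (R '' F)) := by
    refine BoundedContinuousFunction.arzela_ascoli (Metric.closedBall 0 (C * M))
      (isCompact_closedBall _ _) _ ?_ fun z => ?_
    · rintro _ z ⟨f, hf, rfl⟩
      rw [mem_closedBall_zero_iff, hR]
      exact (hC f z z.2).trans (by gcongr; exact hM f hf)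
    · obtain ⟨r, hr, hrD⟩ :=
        Metric.nhds_basis_closedBall.mem_iff.1 (Ω.isOpen_D.mem_nhds (hKD z.2))
      obtain ⟨C', hC'0, hC'⟩ := Ω.exists_norm_fderiv_le p t (isCompact_closedBall _ r) hrD
      refine Metric.equicontinuousAt_iff.2 fun ε hε => ?_
      -- Every `f ∈ F` is `C' * M`-Lipschitz on the ball of radius `r`; the `+ 1` keeps the
      -- denominator positive.
      refine ⟨min r (ε / (C' * M + 1)), by positivity, fun w hw => ?_⟩
      rintro ⟨_, f, hf, rfl⟩
      rw [lt_min_iff, lt_div_iff₀ (by positivity), Subtype.dist_eq] at hw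
      have h := (convex_closedBall (z : EuclideanSpace ℂ (Fin n)) r).norm_image_sub_le_of_norm_fderiv_le
        (𝕜 := ℂ) (f := f.toFun) (C := C' * M) (x := z) (y := w)
        (fun x hx => f.property.1.differentiableAt (Ω.isOpen_D.mem_nhds (hrD hx)))
        (fun x hx => (hC' f x hx).trans (by gcongr; exact hM f hf))
        (Metric.mem_closedBall_self hr.le) hw.1.le
      rw [← dist_eq_norm, ← dist_eq_norm] at h
      change dist (f.toFun z) (f.toFun w) < ε
      rw [dist_comm]
      nlinarith [dist_nonneg (x := (w : EuclideanSpace ℂ (Fin n))) (y := z)]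
  obtain ⟨T, hT, hTF, hTc⟩ := exists_subset_image_finite_and.1
    (Metric.finite_approx_of_totallyBounded (hcpt.totallyBounded.subset subset_closure) η hη)
  refine ⟨T, hT, hTF, fun f hf => ?_⟩
  have h := hTc (mem_image_of_mem R hf)
  simp only [mem_iUnion, mem_image, exists_prop, exists_exists_and_eq_and] at h
  obtain ⟨g, hg, hfg⟩ := h
  refine ⟨g, hg, fun z hz => ?_⟩
  have h1 := (BoundedContinuousFunction.dist_coe_le_dist (f := R f) (g := R g) ⟨z, hz⟩).trans
    (Metric.mem_ball.1 hfg).le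
  rwa [dist_eq_norm] at h1

theorem isCompact_setOf_le_infDist_frontier (δ : ℝ) :
    IsCompact {z ∈ closure Ω.D | δ ≤ Metric.infDist z (frontier Ω.D)} :=
  (Ω.isBounded_D.isCompact_closure).inter_right
    (isClosed_le continuous_const (Metric.continuous_infDist_pt _))

theorem setOf_le_infDist_frontier_subset {δ : ℝ} (hδ : 0 < δ) :
    {z ∈ closure Ω.D | δ ≤ Metric.infDist z (frontier Ω.D)} ⊆ Ω.D := by
  rintro z ⟨hz, hzδ⟩
  by_contra hzD
  have : z ∈ frontier Ω.D := by
    rw [Ω.isOpen_D.frontier_eq]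
    exact ⟨hz, hzD⟩
  rw [Metric.infDist_zero_of_mem this] at hzδ
  linarith

theorem tendsto_iSup_energy_of_totallyBounded (hn : 1 ≤ n) {p t : ℝ} [hp : Fact (1 ≤ p)]
    {F : Set (Ω.BergmanSpace p t)} (hF : TotallyBounded F) :
    Tendsto (fun δ : ℝ => ⨆ f ∈ F, Ω.energy p t (Ω.D \ Ω.shrink δ) f.toFun) (𝓝[>] 0) (𝓝 0) := by
  have hp0 : 0 < p := one_pos.trans_le hp.out
  have hc : (2 : ℝ≥0∞) ^ (p - 1) ≠ ∞ :=
    ENNReal.rpow_ne_top_of_nonneg (by linarith [hp.out]) ENNReal.ofNat_ne_top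
  refine ENNReal.tendsto_nhds_zero.2 fun ε hε => ?_
  obtain ⟨η, hη, hηε⟩ := ENNReal.exists_pos_mul_ofReal_rpow_le hp0 hc (ENNReal.half_pos hε.ne')
  obtain ⟨T, hTF, hT⟩ := Metric.totallyBounded_iff.1 hF η hη
  have hev : ∀ᶠ δ in 𝓝[>] (0 : ℝ), ∀ g ∈ T,
      2 ^ (p - 1) * Ω.energy p t (Ω.D \ Ω.shrink δ) g.toFun ≤ ε / 2 := by
    refine (eventually_all_finite hTF).2 fun g _ => ?_
    have h := ENNReal.Tendsto.const_mul (Ω.tendsto_energy_diff_shrink hn g) (Or.inr hc)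
    rw [mul_zero] at h
    exact ENNReal.tendsto_nhds_zero.1 h _ (ENNReal.half_pos hε.ne')
  filter_upwards [hev] with δ hδ
  refine iSup₂_le fun f hf => ?_
  obtain ⟨g, hg, hfg⟩ := mem_iUnion₂.1 (hT hf)
  have hfg' : Ω.energy p t Ω.D (f - g).toFun ≤ ENNReal.ofReal η ^ p := by
    rw [Ω.energy_eq_ofReal_norm_rpow, ← dist_eq_norm]
    gcongr
    exact (Metric.mem_ball.1 hfg).le
  calc Ω.energy p t (Ω.D \ Ω.shrink δ) f.toFun
      ≤ 2 ^ (p - 1) * (Ω.energy p t (Ω.D \ Ω.shrink δ) g.toFun +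
          Ω.energy p t (Ω.D \ Ω.shrink δ) (f - g).toFun) := by
        refine Ω.energy_le_mul_energy_add_energy_sub hp.out t
          (Ω.isOpen_D.measurableSet.diff (Ω.isOpen_shrink δ).measurableSet) sdiff_subset
          g.property.1 fun z => ?_
        rw [toFun_sub]
        simpa using enorm_add_le (g.toFun z) (f.toFun z - g.toFun z)
    _ ≤ ε / 2 + ε / 2 := by
        rw [mul_add]
        refine add_le_add (hδ g hg) (le_trans ?_ hηε)
        gcongr
        exact (lintegral_mono_set sdiff_subset).trans hfg'
    _ = ε := ENNReal.add_halves ε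

theorem totallyBounded_of_tendsto_iSup_energy {p t : ℝ} [hp : Fact (1 ≤ p)]
    {F : Set (Ω.BergmanSpace p t)} (hF : Bornology.IsBounded F)
    (h : Tendsto (fun δ : ℝ => ⨆ f ∈ F, Ω.energy p t (Ω.D \ Ω.shrink δ) f.toFun)
      (𝓝[>] 0) (𝓝 0)) : TotallyBounded F := by
  have hp0 : 0 < p := one_pos.trans_le hp.out
  have hc : (2 : ℝ≥0∞) ^ (p - 1) ≠ ∞ :=
    ENNReal.rpow_ne_top_of_nonneg (by linarith [hp.out]) ENNReal.ofNat_ne_top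
  refine Metric.totallyBounded_iff.2 fun ε hε => ?_
  -- The interior and the boundary layer each receive half of `(ε / 2) ^ p`; using `ε / 2` makes the
  -- final inequality strict.
  have hε0 : 0 < ENNReal.ofReal (ε / 2) ^ p / 2 :=
    ENNReal.half_pos (ENNReal.rpow_pos (by simpa using hε) ENNReal.ofReal_ne_top).ne'
  -- The supremum occurs twice, once for `f` and once for the net point `g`, which also lies in `F`.
  have h2 : Tendsto (fun δ : ℝ => 2 ^ (p - 1) *
      ((⨆ f ∈ F, Ω.energy p t (Ω.D \ Ω.shrink δ) f.toFun) +
        ⨆ f ∈ F, Ω.energy p t (Ω.D \ Ω.shrink δ) f.toFun)) (𝓝[>] 0) (𝓝 0) := by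
    simpa using ENNReal.Tendsto.const_mul (h.add h) (Or.inr hc)
  obtain ⟨δ, hδ, hδ0⟩ :=
    ((ENNReal.tendsto_nhds_zero.1 h2 _ hε0).and self_mem_nhdsWithin).exists
  -- The non-strict inequality makes `K` closed; it still contains `Ω.shrink δ`, so `K` and the
  -- boundary layer cover `D`.
  obtain ⟨K, hK⟩ : ∃ K, K = {z ∈ closure Ω.D | δ ≤ Metric.infDist z (frontier Ω.D)} := ⟨_, rfl⟩
  have hKc : IsCompact K := hK ▸ Ω.isCompact_setOf_le_infDist_frontier δ
  have hKD : K ⊆ Ω.D := hK ▸ Ω.setOf_le_infDist_frontier_subset hδ0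
  obtain ⟨η, hη, hηε⟩ := ENNReal.exists_pos_mul_ofReal_rpow_le hp0
    (Ω.setLIntegral_weight_lt_top t hKc hKD).ne hε0
  obtain ⟨T, hTF, hT, hnet⟩ := Ω.exists_finite_net_of_isBounded hKc hKD hF hη
  refine ⟨T, hT, fun f hf => ?_⟩
  obtain ⟨g, hg, hfg⟩ := hnet f hf
  refine mem_iUnion₂.2 ⟨g, hg, ?_⟩
  have hin : Ω.energy p t K (f - g).toFun ≤ ENNReal.ofReal (ε / 2) ^ p / 2 := by
    refine le_trans ?_ hηε
    rw [mul_comm, ← lintegral_const_mul' _ _ (ENNReal.rpow_ne_top_of_nonneg hp0.le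
      ENNReal.ofReal_ne_top)]
    refine setLIntegral_mono' hKc.measurableSet fun z hz => ?_
    gcongr
    rw [← ofReal_norm]
    exact ENNReal.ofReal_le_ofReal (hfg z hz)
  have hout : Ω.energy p t (Ω.D \ Ω.shrink δ) (f - g).toFun ≤
      ENNReal.ofReal (ε / 2) ^ p / 2 := by
    refine le_trans ?_ hδ
    refine (Ω.energy_le_mul_energy_add_energy_sub hp.out t
      (Ω.isOpen_D.measurableSet.diff (Ω.isOpen_shrink δ).measurableSet) sdiff_subset
      f.property.1 (h := g.toFun) fun z => enorm_sub_le).trans ?_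
    gcongr
    · exact le_iSup₂_of_le f hf le_rfl
    · exact le_iSup₂_of_le g (hTF hg) le_rfl
  have htot : ENNReal.ofReal ‖f - g‖ ^ p ≤ ENNReal.ofReal (ε / 2) ^ p := by
    rw [← Ω.energy_eq_ofReal_norm_rpow, ← ENNReal.add_halves (ENNReal.ofReal (ε / 2) ^ p)]
    have hsub : Ω.D ⊆ K ∪ (Ω.D \ Ω.shrink δ) := fun z hz => by
      by_cases hzδ : z ∈ Ω.shrink δ
      · exact Or.inl (hK ▸ ⟨subset_closure hz, hzδ.2.le⟩)
      · exact Or.inr ⟨hz, hzδ⟩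
    exact (lintegral_mono_set hsub).trans
      ((lintegral_union_le _ _ _).trans (add_le_add hin hout))
  rw [ENNReal.rpow_le_rpow_iff hp0, ENNReal.ofReal_le_ofReal_iff (by positivity)] at htot
  rw [Metric.mem_ball, dist_eq_norm]
  linarith

end PshDomain

theorem mainTheorem7 {n : ℕ} (hn : 1 ≤ n) (Ω : PshDomain n) (p t : ℝ) [Fact (1 ≤ p)]
    (ht : -1 < t) (F : Set (Ω.BergmanSpace p t)) (hF : Bornology.IsBounded F) :
    IsCompact (closure F) ↔
      Tendsto (fun δ : ℝ => ⨆ f ∈ F, Ω.energy p t (Ω.D \ Ω.shrink δ) f.toFun) (𝓝[>] 0) (𝓝 0) :=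
  ⟨fun h => Ω.tendsto_iSup_energy_of_totallyBounded hn (h.totallyBounded.subset subset_closure),
    fun h => (Ω.totallyBounded_of_tendsto_iSup_energy hF h).closure.isCompact_of_isClosed
      isClosed_closure⟩
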